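/- Let $p$ be an odd prime, let $m,s\ge 1$ be integers, and let $\mathcal R=\mathbb F_{p^m}[u,v]/\langle u^2,v^2,uv-vu\rangle=\mathbb F_{p^m}+u\mathbb F_{p^m}+v\mathbb F_{p^m}+uv\mathbb F_{p^m}$. Let $\alpha=\alpha_1+\alpha_3v+\alpha_4uv$ with $\alpha_1,\alpha_3\in\mathbb F_{p^m}\setminus\{0\}$ and $\alpha_4\in\mathbb F_{p^m}$, and suppose that $\alpha$ is not a square in $\mathcal R$. Let $\alpha_0=\alpha_1^{p^{m-r_0}}$, where $r_0$ is the remainder of $s$ on division by $m$ (so that $\alpha_0^{p^s}=\alpha_1$). Ideals of $\mathcal R_\alpha=\mathcal R[x]/\langle x^{2p^s}-\alpha\rangle$ are regarded as codes of length $2p^s$ over $\mathcal R$ by identifying $c_0+c_1x+\cdots+c_{2p^s-1}x^{2p^s-1}$ with $(c_0,\dots,c_{2p^s-1})$, and $d_H$ denotes the minimum Hamming distance between distinct codewords. Let $0\le \ell\le 2p^s-1$ and $0\le t<\ell$, let $z(x)\in\mathcal R_\alpha$ be $0$ or a unit, let $\Im$ be the smallest integer $k\ge 0$ with $u(x^2-\alpha_0)^{k}\in\langle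 (x^2-\alpha_0)^\ell+u(x^2-\alpha_0)^tz(x)\rangle$, and let $0\le\mu\le\Im$. Let $$\mathcal C=\langle (x^2-\alpha_0)^\ell+u(x^2-\alpha_0)^tz(x),\ u(x^2-\alpha_0)^\mu\rangle .$$ Then $d_H(\mathcal C)=d_H(\langle u(x^2-\alpha_0)^\mu\rangle)$, and $$d_H(\mathcal C)=\begin{cases}1 & \text{if } 0\le\mu\le p^s;\\ (\Gamma+1)p^\gamma & \text{if } 2p^s-p^{s-\gamma}+(\Gamma-1)p^{s-\gamma-1}+1\le\mu\le 2p^s-p^{s-\gamma}+\Gamma p^{s-\gamma-1},\\ & \text{where } 1\le\Gamma\le p-1 \text{ and } 0\le\gamma\le s-1.\end{cases}$$ -/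

import Mathlib

open Polynomial

noncomputable section

/-- The ring `F[u, v] / ⟨u², v², uv - vu⟩ = F + uF + vF + uvF`, built as the dual numbers in `u`
over the dual numbers in `v` over `F`. -/
abbrev RingUV (F : Type*) [Field F] : Type _ := DualNumber (DualNumber F)

namespace RingUV

/-- The generator `u`. -/
def u (F : Type*) [Field F] : RingUV F := DualNumber.eps

/-- The generator `v`. -/
def v (F : Type*) [Field F] : RingUV F := TrivSqZeroExt.inl DualNumber.eps

/-- The element `a + b u + c v + d uv`. -/
def elt {F : Type*} [Field F] (a b c d : F) : RingUV F :=
  algebraMap F (RingUV F) a + algebraMap F (RingUV F) b * u F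
    + algebraMap F (RingUV F) c * v F + algebraMap F (RingUV F) d * (u F * v F)

theorem u_sq (F : Type*) [Field F] : u F ^ 2 = 0 := by
  rw [pow_two]; exact DualNumber.eps_mul_eps

theorem v_sq (F : Type*) [Field F] : v F ^ 2 = 0 := by
  rw [pow_two, v, ← TrivSqZeroExt.inl_mul, DualNumber.eps_mul_eps, TrivSqZeroExt.inl_zero]

theorem fst_fst_elt {F : Type*} [Field F] (a b c d : F) : (elt a b c d).fst.fst = a := by
  simp [elt, u, v, TrivSqZeroExt.algebraMap_eq_inl']

theorem fst_snd_elt {F : Type*} [Field F] (a b c d : F) : (elt a b c d).fst.snd = c := by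
  simp [elt, u, v, TrivSqZeroExt.algebraMap_eq_inl']

theorem snd_fst_elt {F : Type*} [Field F] (a b c d : F) : (elt a b c d).snd.fst = b := by
  simp [elt, u, v, TrivSqZeroExt.algebraMap_eq_inl']

theorem snd_snd_elt {F : Type*} [Field F] (a b c d : F) : (elt a b c d).snd.snd = d := by
  simp [elt, u, v, TrivSqZeroExt.algebraMap_eq_inl']

/-- `1, u, v, uv` is a basis over `F`: each element is `a + b u + c v + d uv` for unique
coefficients. -/
theorem existsUnique_elt {F : Type*} [Field F] (r : RingUV F) :
    ∃! w : F × F × F × F, r = elt w.1 w.2.1 w.2.2.1 w.2.2.2 := by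
  refine ⟨(r.fst.fst, r.snd.fst, r.fst.snd, r.snd.snd), ?_, ?_⟩
  · exact TrivSqZeroExt.ext
      (TrivSqZeroExt.ext (fst_fst_elt _ _ _ _).symm (fst_snd_elt _ _ _ _).symm)
      (TrivSqZeroExt.ext (snd_fst_elt _ _ _ _).symm (snd_snd_elt _ _ _ _).symm)
  · rintro ⟨a, b, c, d⟩ rfl
    simp only [fst_fst_elt, fst_snd_elt, snd_fst_elt, snd_snd_elt]

end RingUV

/-- The ring `R[x] / ⟨xⁿ - α⟩`, whose ideals are the `α`-constacyclic codes of length `n`. -/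
abbrev ConstaRing (R : Type*) [CommRing R] (n : ℕ) (α : R) : Type _ :=
  AdjoinRoot (X ^ n - C α : R[X])

namespace ConstaRing

/-- The code in `Rⁿ` given by an ideal: the words `(c₀, …, cₙ₋₁)` whose polynomial
representation `c₀ + c₁ x + ⋯ + cₙ₋₁ xⁿ⁻¹` lies in the ideal. -/
def code {R : Type*} [CommRing R] {n : ℕ} {α : R} (I : Ideal (ConstaRing R n α)) :
    Set (Fin n → R) :=
  {c | AdjoinRoot.mk (X ^ n - C α) (∑ i : Fin n, C (c i) * X ^ (i : ℕ)) ∈ I}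

end ConstaRing

open scoped Classical in
/-- The minimum Hamming distance between two distinct words of a code
(`0` if the code has at most one word). -/
def codeHammingDist {A : Type*} {n : ℕ} (K : Set (Fin n → A)) : ℕ :=
  sInf {d | ∃ x ∈ K, ∃ y ∈ K, x ≠ y ∧ d = hammingDist x y}

/-- The Hamming distance of a constacyclic code given as an ideal. -/
def idealHammingDist {R : Type*} [CommRing R] {n : ℕ} {α : R}
    (I : Ideal (ConstaRing R n α)) : ℕ :=
  codeHammingDist (ConstaRing.code I)

/-- The element `α₀ = α₁ ^ (p ^ (m - r₀))` of a field with `p ^ m` elements, where `r₀` is the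
remainder of `s` on division by `m`; it is the `p ^ s`-th root of `α₁`. -/
def alphaZero {F : Type*} [Field F] (p m s : ℕ) (α₁ : F) : F := α₁ ^ p ^ (m - s % m)

/-- The class of `u` in `R[x] / ⟨xⁿ - α⟩`, `R = F[u, v] / ⟨u², v²⟩`. -/
def uBar {F : Type*} [Field F] (n : ℕ) (α : RingUV F) : ConstaRing (RingUV F) n α :=
  AdjoinRoot.of (X ^ n - C α) (RingUV.u F)

/-- The class of `x² - a` in `R[x] / ⟨xⁿ - α⟩`, `R = F[u, v] / ⟨u², v²⟩`, for `a ∈ F`. -/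
def yBar {F : Type*} [Field F] (n : ℕ) (α : RingUV F) (a : F) : ConstaRing (RingUV F) n α :=
  AdjoinRoot.mk (X ^ n - C α) (X ^ 2 - C (algebraMap F (RingUV F) a))

/-- The smallest `k` with `u (x² - a)ᵏ ∈ ⟨g⟩`. -/
def uIndex {F : Type*} [Field F] {n : ℕ} {α : RingUV F} (a : F)
    (g : ConstaRing (RingUV F) n α) : ℕ :=
  sInf {k | uBar n α * yBar n α a ^ k ∈ Ideal.span {g}}

end

/-! Write q = p^s, n = 2q, a = α₀, y = x² - a and g for the first generator. Frobenius gives y^q =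
xⁿ - α₁ = α₃v + α₄uv, so y^(2q) = 0 and u y^q = α₃uv with α₃ invertible.

Second generator (`exists_eq_uvWord`, `mul_pow_le_card_support`): ⟨u y^μ⟩ contains uv if μ ≤ q,
hence a word of weight 1. If μ = q + i with i ≤ q, its words are exactly uv·f, with f over F a
multiple of (x² - a)ⁱ of degree below 2q, and the weight is the number of terms of f. Passing to
even or odd parts replaces x² by X and leaves multiples of (X - a)ⁱ of degree below p^s. Hasse
derivatives and base-p splitting bound their number of terms from below; a power of X² - a attains
the bound.

Removing g (`idealHammingDist_span_pair`): let c be a nonzero word of the full code. If uc ≠ 0, then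
uc lies in ⟨u y^l⟩ ⊆ ⟨u y^μ⟩ and is no heavier than c. If uc = 0, then c is already in ⟨u y^μ⟩,
because the annihilator of u meets F[x] in multiples of y^(2q) (`dvd_of_uBar_mul_mkF_eq_zero`). -/

noncomputable section

/-! ### Number of terms of multiples of powers of `X - a` in characteristic p -/

namespace Polynomial

theorem hasseDeriv_succ_X_sub_C_mul {R : Type*} [CommRing R] (a : R) (k : ℕ) (g : R[X]) :
    hasseDeriv (k + 1) ((X - C a) * g)
      = (X - C a) * hasseDeriv (k + 1) g + hasseDeriv k g := by
  have hX : hasseDeriv (k + 1) (X * g) = X * hasseDeriv (k + 1) g + hasseDeriv k g := by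
    ext n
    rw [coeff_add, hasseDeriv_coeff, hasseDeriv_coeff, ← add_assoc, coeff_X_mul]
    cases n with
    | zero => simp
    | succ n =>
      rw [coeff_X_mul, hasseDeriv_coeff, show n + 1 + k + 1 = (n + 1 + k) + 1 by ring,
        Nat.choose_succ_succ, show n + (k + 1) = n + 1 + k by ring]
      push_cast
      ring
  have hC : hasseDeriv (k + 1) (C a * g) = C a * hasseDeriv (k + 1) g := by
    rw [← smul_eq_C_mul, ← smul_eq_C_mul, map_smul]
  rw [sub_mul, map_sub, hX, hC]
  ring

/-- Hasse derivatives lower multiplicity by at most their order in every characteristic; ordinary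
derivatives of order p^e would vanish. -/
theorem X_sub_C_pow_dvd_hasseDeriv {R : Type*} [CommRing R] (a : R) (n k : ℕ) {f : R[X]}
    (h : (X - C a) ^ (n + k) ∣ f) : (X - C a) ^ n ∣ hasseDeriv k f := by
  obtain ⟨g, rfl⟩ := h
  induction k generalizing n with
  | zero => simp
  | succ k ihk =>
    induction n with
    | zero => simp
    | succ n ihn =>
      rw [show n + 1 + (k + 1) = (n + (k + 1)) + 1 by ring, pow_succ' _ (n + (k + 1)), mul_assoc,
        hasseDeriv_succ_X_sub_C_mul]
      refine dvd_add ?_ ?_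
      · rw [pow_succ']
        exact mul_dvd_mul_left _ ihn
      · rw [show n + (k + 1) = n + 1 + k by ring]
        exact ihk (n + 1)

theorem card_support_X_pow_mul {R : Type*} [Semiring R] (j : ℕ) (g : R[X]) :
    (X ^ j * g).support.card = g.support.card := by
  refine le_antisymm ((card_support_mul_le).trans ?_) ?_
  · calc _ ≤ 1 * g.support.card :=
          Nat.mul_le_mul_right _ (by
            rw [← monomial_one_right_eq_X_pow]; exact (Finset.card_le_card (support_monomial_subset j _)).trans (by simp))
      _ = _ := one_mul _
  · refine Finset.card_le_card_of_injOn (· + j) ?_ (fun _ _ _ _ h => Nat.add_right_cancel h)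
    intro n hn
    simpa [coeff_X_pow_mul] using hn

end Polynomial

/-- By Lucas, the binomial is congruent mod p to ⌊n / p^e⌋, which lies between 1 and p - 1. -/
theorem Nat.Prime.not_dvd_choose_pow {p : ℕ} (hp : p.Prime) {e n : ℕ} (h₁ : p ^ e ≤ n)
    (h₂ : n < p * p ^ e) : ¬ p ∣ n.choose (p ^ e) := by
  have := Fact.mk hp
  have hpos : 0 < p ^ e := pow_pos hp.pos e
  have h := Choose.choose_modEq_choose_mul_prod_range_choose (n := n) (k := p ^ e) (p := p) e
  rw [Nat.div_self hpos, Nat.choose_one_right] at h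
  have h1 : ∏ i ∈ Finset.range e, (n / p ^ i % p).choose (p ^ e / p ^ i % p) = 1 := by
    refine Finset.prod_eq_one fun i hi => ?_
    have hi' : i < e := Finset.mem_range.1 hi
    rw [Nat.pow_div hi'.le hp.pos, Nat.mod_eq_zero_of_dvd (dvd_pow_self p (by omega)),
      Nat.choose_zero_right]
  intro hd
  have h2 : (p : ℤ) ∣ ((n / p ^ e : ℕ) : ℤ) := by
    have h3 := h.dvd
    have h4 : (p : ℤ) ∣ (n.choose (p ^ e) : ℤ) := by exact_mod_cast hd
    have h5 := (dvd_add h3 h4)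
    rw [sub_add_cancel] at h5
    have h1' : ∏ i ∈ Finset.range e, ((n / p ^ i % p).choose (p ^ e / p ^ i % p) : ℤ) = 1 := by
      exact_mod_cast h1
    simpa [h1'] using h5
  have h6 : p ∣ n / p ^ e := by exact_mod_cast h2
  have h7 : 0 < n / p ^ e := Nat.div_pos h₁ hpos
  have h8 := Nat.le_of_dvd h7 h6
  have h9 : n / p ^ e < p := by rw [Nat.div_lt_iff_lt_mul hpos]; exact h₂
  omega

namespace Polynomial

variable {F : Type*} [Field F]

/-- Normalises to a nonzero constant term without changing the number of terms; divisibility by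
powers of `X - a` survives since a ≠ 0. -/
theorem exists_eq_X_pow_mul {f : F[X]} (hf : f ≠ 0) :
    ∃ j g, f = X ^ j * g ∧ g.coeff 0 ≠ 0 := by
  obtain ⟨g, hg, hg'⟩ := exists_eq_pow_rootMultiplicity_mul_and_not_dvd f hf 0
  rw [C_0, sub_zero] at hg hg'
  exact ⟨_, g, hg, fun h => hg' (X_dvd_iff.2 h)⟩

theorem isCoprime_X_sub_C_pow_X {a : F} (ha : a ≠ 0) (n : ℕ) (j : ℕ) :
    IsCoprime ((X - C a : F[X]) ^ n) (X ^ j) := by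
  refine IsCoprime.pow ?_
  have := isCoprime_X_sub_C_of_isUnit_sub (R := F) (a := a) (b := 0) (by simpa using ha)
  simpa using this

/-- A nonzero multiple of `(X - a) ^ (k pᵉ + 1)` of degree less than `p ^ (e + 1)` has at least
`k + 2` terms. -/
theorem le_card_support_of_X_sub_C_pow_dvd (p : ℕ) [hp : Fact p.Prime] [CharP F p] {a : F}
    (ha : a ≠ 0) (e k : ℕ) {f : F[X]} (hf : f ≠ 0) (hdeg : f.natDegree < p * p ^ e)
    (hdvd : (X - C a) ^ (k * p ^ e + 1) ∣ f) : k + 2 ≤ f.support.card := by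
  have hpos : 0 < p ^ e := pow_pos hp.out.pos e
  induction k generalizing f with
  | zero =>
    obtain ⟨j, g, rfl, hg0⟩ := exists_eq_X_pow_mul hf
    rw [card_support_X_pow_mul]
    have hg : g ≠ 0 := by rintro rfl; simp at hg0
    replace hdvd := (isCoprime_X_sub_C_pow_X ha _ _).dvd_of_dvd_mul_left hdvd
    have hle := natDegree_le_of_dvd hdvd hg
    rw [natDegree_pow, natDegree_X_sub_C, mul_one] at hle
    exact Finset.one_lt_card.2 ⟨0, mem_support_iff.2 hg0, _,
      natDegree_mem_support_of_nonzero hg, by omega⟩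
  | succ k ih =>
    obtain ⟨j, g, rfl, hg0⟩ := exists_eq_X_pow_mul hf
    rw [card_support_X_pow_mul]
    have hg : g ≠ 0 := by rintro rfl; simp at hg0
    replace hdvd := (isCoprime_X_sub_C_pow_X ha _ _).dvd_of_dvd_mul_left hdvd
    replace hdeg : g.natDegree < p * p ^ e := by
      rw [natDegree_mul (by simp) hg] at hdeg
      omega
    have hle : (k + 1) * p ^ e + 1 ≤ g.natDegree := by
      have := natDegree_le_of_dvd hdvd hg
      rwa [natDegree_pow, natDegree_X_sub_C, mul_one] at this
    have hMle : p ^ e ≤ g.natDegree := by nlinarith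
    -- The leading term survives: its binomial factor is prime to p.
    have hD : hasseDeriv (p ^ e) g ≠ 0 := by
      intro h
      have h1 := congrArg (coeff · (g.natDegree - p ^ e)) h
      simp only [hasseDeriv_coeff, coeff_zero, Nat.sub_add_cancel hMle] at h1
      rcases mul_eq_zero.1 h1 with h2 | h2
      · exact hp.out.not_dvd_choose_pow hMle hdeg ((CharP.cast_eq_zero_iff F p _).1 h2)
      · exact hg (leadingCoeff_eq_zero.1 h2)
    have h3 := ih hD ((natDegree_hasseDeriv_le g _).trans_lt (by omega))
      (X_sub_C_pow_dvd_hasseDeriv a _ _ (by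
        rwa [show k * p ^ e + 1 + p ^ e = (k + 1) * p ^ e + 1 by ring]))
    -- Each term of the derivative comes from a term of g of degree at least p^e, so the constant
    -- term is lost: one term is gained per step of the induction.
    have h4 : (hasseDeriv (p ^ e) g).support.card ≤ (g.support.erase 0).card := by
      refine Finset.card_le_card_of_injOn (· + p ^ e) ?_
        (fun _ _ _ _ h => Nat.add_right_cancel h)
      intro n hn
      have hn' := mem_support_iff.1 hn
      rw [hasseDeriv_coeff] at hn'
      exact Finset.mem_erase.2 ⟨(Nat.add_pos_right n hpos).ne', mem_support_iff.2 (right_ne_zero_of_mul hn')⟩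
    have h5 := Finset.card_erase_add_one (mem_support_iff.2 hg0)
    omega

/-- Since deg h < M, the shifted copies of h occupy disjoint blocks of exponents. -/
theorem coeff_expand_mul_add_of_natDegree_lt {R : Type*} [CommSemiring R] {M : ℕ}
    (G h : R[X]) (hh : h.natDegree < M) (j : ℕ) {n : ℕ} (hn : n < M) :
    (expand R M G * h).coeff (M * j + n) = G.coeff j * h.coeff n := by
  induction G using Polynomial.induction_on' with
  | add G₁ G₂ h₁ h₂ => rw [map_add, add_mul, coeff_add, h₁, h₂, coeff_add, add_mul]
  | monomial k c =>
    rw [expand_monomial, ← C_mul_X_pow_eq_monomial, mul_assoc, coeff_C_mul, coeff_X_pow_mul',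
      coeff_monomial]
    rcases lt_trichotomy k j with hkj | rfl | hkj
    · have : k * M + M ≤ M * j := by nlinarith
      rw [if_pos (by omega), coeff_eq_zero_of_natDegree_lt (by omega), if_neg hkj.ne]
      simp
    · rw [if_pos (by rw [mul_comm]; omega), if_pos rfl, mul_comm k M, Nat.add_sub_cancel_left]
    · have : M * j + M ≤ k * M := by nlinarith
      rw [if_neg (by omega), if_neg hkj.ne']
      simp

theorem card_support_mul_card_support_le_expand_mul {R : Type*} [CommSemiring R]
    [NoZeroDivisors R] {M : ℕ} (hM : 0 < M) (G h : R[X]) (hh : h.natDegree < M) :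
    G.support.card * h.support.card ≤ (expand R M G * h).support.card := by
  rw [← Finset.card_product]
  have hlt : ∀ n ∈ h.support, n < M := fun n hn => (le_natDegree_of_mem_supp n hn).trans_lt hh
  refine Finset.card_le_card_of_injOn (fun x => M * x.1 + x.2) ?_ ?_
  · rintro ⟨j, n⟩ hx
    obtain ⟨h1, h2⟩ := Finset.mem_product.1 (Finset.mem_coe.1 hx)
    refine mem_support_iff.2 ?_
    rw [coeff_expand_mul_add_of_natDegree_lt G h hh j (hlt n h2)]
    exact mul_ne_zero (mem_support_iff.1 h1) (mem_support_iff.1 h2)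
  · rintro ⟨j, n⟩ hx ⟨j', n'⟩ hx' hxx
    have h2 := hlt n (Finset.mem_product.1 (Finset.mem_coe.1 hx)).2
    have h2' := hlt n' (Finset.mem_product.1 (Finset.mem_coe.1 hx')).2
    simp only at hxx
    have e1 : j = j' := by
      have := congrArg (· / M) hxx
      simpa [Nat.mul_add_div hM, Nat.div_eq_of_lt h2, Nat.div_eq_of_lt h2'] using this
    subst e1
    simpa using hxx

theorem X_sub_C_pow_char_pow (p : ℕ) [Fact p.Prime] [CharP F p] (a : F) (e : ℕ) :
    (X - C a : F[X]) ^ p ^ e = expand F (p ^ e) (X - C (a ^ p ^ e)) := by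
  rw [sub_pow_char_pow, map_sub, expand_X, expand_C, C_pow]

theorem card_support_X_sub_C_pow_char_sub_one (p : ℕ) [hp : Fact p.Prime] [CharP F p] {a : F}
    (ha : a ≠ 0) : p ≤ ((X - C a : F[X]) ^ (p - 1)).support.card := by
  have hsub : Finset.range p ⊆ ((X - C a : F[X]) ^ (p - 1)).support := by
    intro j hj
    have hj : j < p := Finset.mem_range.1 hj
    rw [mem_support_iff, sub_eq_add_neg, ← C_neg, coeff_X_add_C_pow]
    refine mul_ne_zero (pow_ne_zero _ (neg_ne_zero.2 ha)) fun h => ?_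
    have h1 := (CharP.cast_eq_zero_iff F p _).1 h
    exact hp.out.one_lt.ne' (Nat.Coprime.eq_one_of_dvd
      (hp.out.coprime_choose_of_lt (Nat.sub_lt hp.out.pos one_pos) (by omega)) h1)
  simpa using Finset.card_le_card hsub

/-- Lower bound for the number of terms of a multiple of a power of `X - a` of degree less than
`p ^ (e + γ + 1)`. -/
theorem mul_pow_le_card_support (p : ℕ) [hp : Fact p.Prime] [CharP F p] {a : F}
    (ha : a ≠ 0) (e k γ i : ℕ) {f : F[X]} (hf : f ≠ 0)
    (hdeg : f.natDegree < p ^ (e + γ + 1))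
    (hi : p ^ (e + γ + 1) + k * p ^ e + 1 ≤ p ^ (e + 1) + i)
    (hdvd : (X - C a) ^ i ∣ f) : (k + 2) * p ^ γ ≤ f.support.card := by
  induction γ generalizing f i with
  | zero =>
    rw [pow_zero, mul_one]
    refine le_card_support_of_X_sub_C_pow_dvd p ha e k hf (by rwa [← pow_succ'])
      ((pow_dvd_pow _ ?_).trans hdvd)
    simp only [add_zero] at hi
    omega
  | succ γ ih =>
    set M := p ^ (e + γ + 1) with hM
    have hMpos : 0 < M := pow_pos hp.out.pos _
    have hpM : p ^ (e + (γ + 1) + 1) = (p - 1) * M + M := by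
      rw [show e + (γ + 1) + 1 = (e + γ + 1) + 1 by ring, pow_succ', ← hM]
      nth_rewrite 3 [← one_mul M]
      rw [← add_mul, Nat.sub_add_cancel hp.out.one_le]
    have hle : p ^ (e + 1) ≤ M := Nat.pow_le_pow_right hp.out.pos (by omega)
    -- The factor (X - a)^((p-1)M) is a polynomial in X^M with p terms, and the cofactor has degree
    -- below M, so the term counts multiply.
    obtain ⟨i', rfl⟩ : ∃ i', i = (p - 1) * M + i' := Nat.exists_eq_add_of_le (by omega)
    obtain ⟨g, rfl⟩ := hdvd
    rw [pow_add (X - C a), mul_assoc ((X - C a) ^ _), mul_comm (p - 1) M, pow_mul (X - C a), hM, X_sub_C_pow_char_pow, ← map_pow,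
      ← hM] at hf hdeg ⊢
    have hh := right_ne_zero_of_mul hf
    have hdeg' : ((X - C a) ^ i' * g).natDegree < M := by
      rw [natDegree_mul (left_ne_zero_of_mul hf) hh, natDegree_expand, natDegree_pow,
        natDegree_X_sub_C, mul_one, hpM] at hdeg
      omega
    have h1 := ih i' hh hdeg' (by omega) (dvd_mul_right _ _)
    refine le_trans ?_ (card_support_mul_card_support_le_expand_mul hMpos _ _ hdeg')
    calc (k + 2) * p ^ (γ + 1) = p * ((k + 2) * p ^ γ) := by ring
      _ ≤ _ := Nat.mul_le_mul (card_support_X_sub_C_pow_char_sub_one p (pow_ne_zero _ ha)) h1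

theorem card_support_expand {R : Type*} [CommSemiring R] {M : ℕ} (hM : 0 < M) (f : R[X]) :
    (expand R M f).support.card ≤ f.support.card := by
  refine Finset.card_le_card_of_injOn (· / M) ?_ ?_
  · intro n hn
    have := mem_support_iff.1 hn
    rw [coeff_expand hM] at this
    split_ifs at this with h
    · exact mem_support_iff.2 this
    · exact absurd rfl this
  · intro n hn m hm h
    have h1 := mem_support_iff.1 hn
    have h2 := mem_support_iff.1 hm
    rw [coeff_expand hM] at h1 h2
    split_ifs at h1 h2 with h3 h4
    · exact (Nat.div_left_inj h3 h4).1 h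
    all_goals exact absurd rfl ‹_›

theorem card_support_X_sub_C_pow_mul_char_pow_le (p : ℕ) [hp : Fact p.Prime] [CharP F p] (a : F)
    (e k : ℕ) : ((X - C a : F[X]) ^ (k * p ^ e)).support.card ≤ k + 1 := by
  rw [mul_comm, pow_mul, X_sub_C_pow_char_pow, ← map_pow]
  refine (card_support_expand (pow_pos hp.out.pos e) _).trans ?_
  refine (card_supp_le_succ_natDegree _).trans ?_
  rw [natDegree_pow, natDegree_X_sub_C, mul_one]

/-- Same splitting as for the lower bound: each factor (X - a)^((p-1)p^(e+γ+1)) has at most p terms.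
-/
theorem card_support_X_sub_C_pow_le (p : ℕ) [hp : Fact p.Prime] [CharP F p] (a : F)
    (e k γ i : ℕ) (hi : i + p ^ (e + 1) = p ^ (e + γ + 1) + k * p ^ e) :
    ((X - C a : F[X]) ^ i).support.card ≤ (k + 1) * p ^ γ := by
  induction γ generalizing i with
  | zero =>
    obtain rfl : i = k * p ^ e := by simp only [add_zero] at hi; omega
    simpa using card_support_X_sub_C_pow_mul_char_pow_le p a e k
  | succ γ ih =>
    have hpM : p ^ (e + (γ + 1) + 1) = (p - 1) * p ^ (e + γ + 1) + p ^ (e + γ + 1) := by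
      rw [show e + (γ + 1) + 1 = (e + γ + 1) + 1 by ring, pow_succ']
      nth_rewrite 3 [← one_mul (p ^ (e + γ + 1))]
      rw [← add_mul, Nat.sub_add_cancel hp.out.one_le]
    have hle : p ^ (e + 1) ≤ p ^ (e + γ + 1) := Nat.pow_le_pow_right hp.out.pos (by omega)
    obtain ⟨i', rfl⟩ : ∃ i', i = (p - 1) * p ^ (e + γ + 1) + i' :=
      Nat.exists_eq_add_of_le (by omega)
    rw [pow_add]
    refine card_support_mul_le.trans ?_
    refine (Nat.mul_le_mul (card_support_X_sub_C_pow_mul_char_pow_le p a _ _)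
      (ih i' (by omega))).trans ?_
    rw [Nat.sub_add_cancel hp.out.one_le]
    exact le_of_eq (by ring)

theorem expand_dvd_contract {R : Type*} [CommRing R] {n : ℕ} (hn : n ≠ 0) {g f : R[X]}
    (h : expand R n g ∣ f) : g ∣ contract n f := by
  obtain ⟨q, rfl⟩ := h
  rw [mul_comm, contract_mul_expand hn]
  exact dvd_mul_left _ _

theorem card_support_contract_le {R : Type*} [CommSemiring R] {n : ℕ} (hn : n ≠ 0) (f : R[X]) :
    (contract n f).support.card ≤ f.support.card := by
  refine Finset.card_le_card_of_injOn (· * n) ?_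
    (fun _ _ _ _ h => Nat.eq_of_mul_eq_mul_right (Nat.pos_of_ne_zero hn) h)
  intro j hj
  have := mem_support_iff.1 hj
  rw [coeff_contract hn] at this
  exact mem_support_iff.2 this

theorem natDegree_lt_of_coeff_eq_zero {R : Type*} [Semiring R] {f : R[X]} {N : ℕ} (hN : 0 < N)
    (h : ∀ n, N ≤ n → f.coeff n = 0) : f.natDegree < N := by
  by_contra! h'
  have hf := leadingCoeff_eq_zero.1 (h _ h')
  rw [hf, natDegree_zero] at h'
  omega

/-- A nonzero multiple of `(X² - a)ⁱ` of degree less than `2 N` yields a nonzero multiple of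
`(X - a)ⁱ` of degree less than `N` with at most as many terms. -/
theorem exists_X_sub_C_pow_dvd_of_X_sq_sub_C_pow_dvd {a : F} (ha : a ≠ 0) {i N : ℕ} {f : F[X]}
    (hf : f ≠ 0) (hdeg : f.natDegree < 2 * N) (hdvd : (X ^ 2 - C a) ^ i ∣ f) :
    ∃ g : F[X], g ≠ 0 ∧ g.natDegree < N ∧ (X - C a) ^ i ∣ g ∧
      g.support.card ≤ f.support.card := by
  have hexp : expand F 2 ((X - C a) ^ i) = (X ^ 2 - C a) ^ i := by simp
  have hN : 0 < N := by omega
  -- Both the even and odd parts of f inherit divisibility by a polynomial in X². If the even part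
  -- vanishes, the odd part is read off from X f, and the extra factor X is coprime to X - a.
  by_cases h0 : contract 2 f = 0
  · have h1 : X ∣ contract 2 (X * f) := by
      rw [X_dvd_iff, coeff_contract two_ne_zero]; simp
    obtain ⟨g, hg⟩ := h1
    have hgc : ∀ n, g.coeff n = f.coeff (2 * n + 1) := by
      intro n
      have := congrArg (coeff · (n + 1)) hg
      simp only [coeff_X_mul, coeff_contract two_ne_zero] at this
      rw [← this, show (n + 1) * 2 = (2 * n + 1) + 1 by ring, coeff_X_mul]
    refine ⟨g, ?_, ?_, ?_, ?_⟩
    · rintro rfl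
      refine hf (ext fun n => ?_)
      rcases Nat.even_or_odd' n with ⟨j, rfl | rfl⟩
      · have := congrArg (coeff · j) h0
        simpa [coeff_contract two_ne_zero, mul_comm] using this
      · simpa using (hgc j).symm
    · refine natDegree_lt_of_coeff_eq_zero hN fun n hn => ?_
      rw [hgc]
      exact coeff_eq_zero_of_natDegree_lt (by omega)
    · have h2 : (X - C a) ^ i ∣ contract 2 (X * f) :=
        expand_dvd_contract two_ne_zero (by rw [hexp]; exact hdvd.mul_left _)
      rw [hg] at h2
      have h3 := isCoprime_X_sub_C_pow_X ha i 1
      rw [pow_one] at h3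
      exact h3.dvd_of_dvd_mul_left h2
    · calc g.support.card = (X ^ 1 * g).support.card := (card_support_X_pow_mul 1 g).symm
        _ = (contract 2 (X * f)).support.card := by rw [pow_one, hg]
        _ ≤ (X ^ 1 * f).support.card := by
          rw [pow_one]; exact card_support_contract_le two_ne_zero _
        _ = f.support.card := card_support_X_pow_mul 1 f
  · refine ⟨contract 2 f, h0, ?_, expand_dvd_contract two_ne_zero (by rwa [hexp]),
      card_support_contract_le two_ne_zero f⟩
    refine natDegree_lt_of_coeff_eq_zero hN fun n hn => ?_
    rw [coeff_contract two_ne_zero]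
    exact coeff_eq_zero_of_natDegree_lt (by omega)

end Polynomial

/-! ### Minimum distance as minimum weight -/

open scoped Classical in
theorem codeHammingDist_eq_sInf_hammingNorm {A : Type*} [AddCommGroup A] {n : ℕ} {K : Set (Fin n → A)}
    (h0 : 0 ∈ K) (hsub : ∀ x ∈ K, ∀ y ∈ K, x - y ∈ K) :
    codeHammingDist K = sInf {d | ∃ x ∈ K, x ≠ 0 ∧ d = hammingNorm x} := by
  unfold codeHammingDist
  congr 1
  ext d
  constructor
  · rintro ⟨x, hx, y, hy, hxy, rfl⟩
    exact ⟨x - y, hsub x hx y hy, sub_ne_zero.2 hxy, by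
      rw [hammingDist_comm, hammingDist_eq_hammingNorm, neg_add_eq_sub]⟩
  · rintro ⟨x, hx, hx0, rfl⟩
    exact ⟨x, hx, 0, h0, hx0, (hammingDist_zero_right x).symm⟩

namespace ConstaRing

variable {R : Type*} [CommRing R] {n : ℕ} {α : R}

theorem mem_code_iff {I : Ideal (ConstaRing R n α)} {c : Fin n → R} :
    c ∈ code I ↔ AdjoinRoot.mk (X ^ n - C α) (∑ i : Fin n, C (c i) * X ^ (i : ℕ)) ∈ I :=
  Iff.rfl

theorem sum_coeff_eq {P : R[X]} (hP : P.degree < n) :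
    ∑ i : Fin n, C (P.coeff i) * X ^ (i : ℕ) = P := by
  rw [Fin.sum_univ_eq_sum_range (fun i => C (P.coeff i) * X ^ i) n]
  by_cases h : P = 0
  · simp [h]
  · exact (as_sum_range_C_mul_X_pow' P ((natDegree_lt_iff_degree_lt h).2 hP)).symm

theorem degree_sum_lt (c : Fin n → R) :
    (∑ i : Fin n, C (c i) * X ^ (i : ℕ)).degree < (n : WithBot ℕ) := by
  refine (degree_lt_iff_coeff_zero _ _).2 fun m hm => ?_
  rw [finsetSum_coeff]
  refine Finset.sum_eq_zero fun i _ => ?_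
  rw [coeff_C_mul_X_pow, if_neg (by have := i.2; omega)]

theorem coeff_sum (c : Fin n → R) (j : Fin n) :
    (∑ i : Fin n, C (c i) * X ^ (i : ℕ)).coeff j = c j := by
  rw [finsetSum_coeff, Finset.sum_eq_single j]
  · simp
  · intro i _ hij
    rw [coeff_C_mul_X_pow, if_neg (fun h => hij (Fin.ext h.symm))]
  · simp

theorem coeff_mem_code_iff {I : Ideal (ConstaRing R n α)} {P : R[X]} (hP : P.degree < n) :
    (fun i : Fin n => P.coeff i) ∈ code I ↔ AdjoinRoot.mk (X ^ n - C α) P ∈ I := by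
  rw [mem_code_iff, sum_coeff_eq hP]

theorem eq_zero_of_mk_eq_zero (hn : 0 < n) {P : R[X]} (hP : P.degree < n)
    (h : AdjoinRoot.mk (X ^ n - C α) P = 0) : P = 0 := by
  rcases subsingleton_or_nontrivial R with _ | _
  · exact Subsingleton.elim _ _
  by_contra h0
  exact (monic_X_pow_sub_C α hn.ne').not_dvd_of_degree_lt h0
    (by rwa [degree_X_pow_sub_C hn]) (AdjoinRoot.mk_eq_zero.1 h)

theorem smul_mem_code {I : Ideal (ConstaRing R n α)} {c : Fin n → R} (r : R) :
    (fun i => r * c i) ∈ code I ↔ AdjoinRoot.of (X ^ n - C α) r *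
      AdjoinRoot.mk (X ^ n - C α) (∑ i : Fin n, C (c i) * X ^ (i : ℕ)) ∈ I := by
  rw [mem_code_iff, ← AdjoinRoot.mk_C, ← map_mul, Finset.mul_sum]
  simp only [C_mul, mul_assoc]

theorem zero_mem_code (I : Ideal (ConstaRing R n α)) : 0 ∈ code I := by
  rw [mem_code_iff]; simp

theorem sub_mem_code {I : Ideal (ConstaRing R n α)} {c d : Fin n → R} (hc : c ∈ code I)
    (hd : d ∈ code I) : c - d ∈ code I := by
  rw [mem_code_iff] at *
  simpa [sub_mul, Finset.sum_sub_distrib] using I.sub_mem hc hd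

end ConstaRing

open ConstaRing

section

variable {R : Type*} [CommRing R] {n : ℕ} {α : R}

open scoped Classical in
theorem idealHammingDist_eq_sInf (I : Ideal (ConstaRing R n α)) :
    idealHammingDist I = sInf {d | ∃ x ∈ code I, x ≠ 0 ∧ d = hammingNorm x} :=
  codeHammingDist_eq_sInf_hammingNorm (zero_mem_code I) fun _ hx _ hy => sub_mem_code hx hy

open scoped Classical in
theorem idealHammingDist_eq_of_le {I J : Ideal (ConstaRing R n α)} (hIJ : I ≤ J)
    (h : ∀ c ∈ code J, c ≠ 0 → ∃ d ∈ code I, d ≠ 0 ∧ hammingNorm d ≤ hammingNorm c) :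
    idealHammingDist J = idealHammingDist I := by
  rw [idealHammingDist_eq_sInf, idealHammingDist_eq_sInf]
  -- Without nonzero words both infima are `sInf ∅ = 0`.
  rcases Set.eq_empty_or_nonempty {d | ∃ x ∈ code J, x ≠ 0 ∧ d = hammingNorm x} with hJ | hJ
  · have hI : {d | ∃ x ∈ code I, x ≠ 0 ∧ d = hammingNorm x} = ∅ :=
      Set.subset_empty_iff.1 fun d ⟨x, hx, hx0, hd⟩ => hJ ▸ ⟨x, hIJ hx, hx0, hd⟩
    rw [hI, hJ]
  · have key : ∃ x ∈ code I, x ≠ 0 ∧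
        hammingNorm x ≤ sInf {d | ∃ x ∈ code J, x ≠ 0 ∧ d = hammingNorm x} := by
      obtain ⟨c, hc, hc0, hcd⟩ := Nat.sInf_mem hJ
      obtain ⟨x, hx, hx0, hle⟩ := h c hc hc0
      exact ⟨x, hx, hx0, hcd ▸ hle⟩
    obtain ⟨x, hx, hx0, hle⟩ := key
    refine le_antisymm ?_ ((Nat.sInf_le (Set.mem_ofPred.2 ⟨x, hx, hx0, rfl⟩)).trans hle)
    obtain ⟨y, hy, hy0, hyd⟩ :=
      Nat.sInf_mem (s := {d | ∃ x ∈ code I, x ≠ 0 ∧ d = hammingNorm x}) ⟨_, x, hx, hx0, rfl⟩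
    exact Nat.sInf_le ⟨y, hIJ hy, hy0, hyd⟩

open scoped Classical in
theorem idealHammingDist_eq {I : Ideal (ConstaRing R n α)} {d : ℕ}
    (hle : ∃ c ∈ code I, c ≠ 0 ∧ hammingNorm c ≤ d)
    (hge : ∀ c ∈ code I, c ≠ 0 → d ≤ hammingNorm c) : idealHammingDist I = d := by
  rw [idealHammingDist_eq_sInf]
  obtain ⟨c, hc, hc0, hcd⟩ := hle
  refine le_antisymm ((Nat.sInf_le (Set.mem_ofPred.2 ⟨c, hc, hc0, rfl⟩)).trans hcd) ?_
  refine le_csInf ⟨_, c, hc, hc0, rfl⟩ ?_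
  rintro _ ⟨x, hx, hx0, rfl⟩
  exact hge x hx hx0

end

/-! ### Arithmetic of the coefficient ring and its quotient; removing the first generator -/

namespace RingUV

variable {F : Type*} [Field F]

theorem eq_zero_of_elt_eq_zero {a b : F} (h : elt 0 a 0 b = 0) : a = 0 ∧ b = 0 :=
  ⟨by rw [← snd_fst_elt 0 a 0 b, h]; rfl, by rw [← snd_snd_elt 0 a 0 b, h]; rfl⟩

theorem u_mul_u : u F * u F = 0 := by rw [← pow_two, u_sq]

theorem v_mul_v : v F * v F = 0 := by rw [← pow_two, v_sq]

/-- As uv kills u and v, multiplication by uv only sees the residue in F. -/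
theorem uv_mul (r : RingUV F) : u F * v F * r = u F * v F * algebraMap F _ r.fst.fst := by
  obtain ⟨⟨a, b, c, d⟩, rfl, -⟩ := existsUnique_elt r
  rw [fst_fst_elt, elt]
  linear_combination (v F * algebraMap F _ b + v F * v F * algebraMap F _ d) * u_mul_u (F := F)
    + u F * algebraMap F _ c * v_mul_v (F := F)

theorem uv_mul_algebraMap_eq_zero {a : F} : u F * v F * algebraMap F _ a = 0 ↔ a = 0 := by
  refine ⟨fun h => ?_, fun h => by simp [h]⟩
  refine (eq_zero_of_elt_eq_zero (a := 0) (b := a) ?_).2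
  rw [elt, ← h]
  simp only [map_zero, zero_mul, zero_add]
  ring

theorem C_uv_mul (P : (RingUV F)[X]) : ∃ Q : F[X],
    C (u F * v F) * P = C (u F * v F) * Q.map (algebraMap F (RingUV F)) := by
  refine ⟨P.map ((TrivSqZeroExt.fstHom F F F).toRingHom.comp
    (TrivSqZeroExt.fstHom (DualNumber F) (DualNumber F) (DualNumber F)).toRingHom), ?_⟩
  ext i : 1
  rw [coeff_C_mul, coeff_C_mul, coeff_map, coeff_map, uv_mul]
  rfl

end RingUV

/-- The class in `R[x] / ⟨xⁿ - α⟩` of a polynomial over the coefficient field. -/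
def mkF {F : Type*} [Field F] (n : ℕ) (α : RingUV F) : F[X] →+* ConstaRing (RingUV F) n α :=
  (AdjoinRoot.mk (X ^ n - C α)).comp (mapRingHom (algebraMap F (RingUV F)))

section

open RingUV

variable {F : Type*} [Field F] {n : ℕ} {α : RingUV F}

theorem mkF_apply (P : F[X]) :
    mkF n α P = AdjoinRoot.mk (X ^ n - C α) (P.map (algebraMap F (RingUV F))) := rfl

theorem yBar_eq (a : F) : yBar n α a = mkF n α (X ^ 2 - C a) := by
  rw [mkF_apply, yBar]; simp

theorem uBar_mul_uBar : uBar n α * uBar n α = 0 := by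
  rw [uBar, ← map_mul, u_mul_u, map_zero]

/-- The class of `v`. -/
def vBar (n : ℕ) (α : RingUV F) : ConstaRing (RingUV F) n α :=
  AdjoinRoot.of (X ^ n - C α) (RingUV.v F)

theorem vBar_mul_vBar : vBar n α * vBar n α = 0 := by
  rw [vBar, ← map_mul, v_mul_v, map_zero]

theorem mk_C_algebraMap (a : F) :
    AdjoinRoot.mk (X ^ n - C α) (C (algebraMap F (RingUV F) a)) = mkF n α (C a) := by
  rw [mkF_apply, map_C]

variable {a α₁ α₃ α₄ : F} {q : ℕ}

theorem yBar_pow_eq (hw : (X ^ 2 - C a : F[X]) ^ q = X ^ n - C α₁)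
    (hα : α = elt α₁ 0 α₃ α₄) :
    yBar n α a ^ q = mkF n α (C α₃) * vBar n α + mkF n α (C α₄) * (uBar n α * vBar n α) := by
  rw [yBar_eq, ← map_pow, hw, mkF_apply, ← mk_C_algebraMap, ← mk_C_algebraMap, vBar, uBar,
    ← AdjoinRoot.mk_C, ← AdjoinRoot.mk_C]
  simp only [← map_mul, ← map_add]
  rw [← sub_eq_zero, ← map_sub, AdjoinRoot.mk_eq_zero, hα, elt]
  refine dvd_of_eq ?_
  simp only [Polynomial.map_sub, Polynomial.map_pow, map_X, map_C, C_add, C_mul, map_zero]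
  ring

theorem yBar_pow_two_mul_eq_zero (hw : (X ^ 2 - C a : F[X]) ^ q = X ^ n - C α₁)
    (hα : α = elt α₁ 0 α₃ α₄) : yBar n α a ^ (2 * q) = 0 := by
  rw [mul_comm, pow_mul, yBar_pow_eq hw hα]
  linear_combination (mkF n α (C α₃) + mkF n α (C α₄) * uBar n α) ^ 2 * vBar_mul_vBar (α := α)

theorem uBar_mul_yBar_pow (hw : (X ^ 2 - C a : F[X]) ^ q = X ^ n - C α₁)
    (hα : α = elt α₁ 0 α₃ α₄) :
    uBar n α * yBar n α a ^ q = mkF n α (C α₃) * (uBar n α * vBar n α) := by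
  rw [yBar_pow_eq hw hα]
  linear_combination (mkF n α (C α₄) * vBar n α) * uBar_mul_uBar (α := α)

theorem mkF_C_inv_mul (h : α₃ ≠ 0) : mkF n α (C α₃⁻¹) * mkF n α (C α₃) = 1 := by
  rw [← map_mul, ← C_mul, inv_mul_cancel₀ h, C_1, map_one]

/-- Modulo u, v equals α₃⁻¹ y^q, so F[x] already surjects onto the quotient by u. -/
theorem exists_mkF_add_uBar_mul (hw : (X ^ 2 - C a : F[X]) ^ q = X ^ n - C α₁)
    (hα : α = elt α₁ 0 α₃ α₄) (hα₃ : α₃ ≠ 0) (e : ConstaRing (RingUV F) n α) :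
    ∃ (P : F[X]) (b : ConstaRing (RingUV F) n α), e = mkF n α P + uBar n α * b := by
  induction e using AdjoinRoot.induction_on with
  | ih Q =>
  induction Q using Polynomial.induction_on' with
  | add Q₁ Q₂ h₁ h₂ =>
    obtain ⟨P₁, b₁, h₁⟩ := h₁
    obtain ⟨P₂, b₂, h₂⟩ := h₂
    exact ⟨P₁ + P₂, b₁ + b₂, by rw [map_add, map_add, h₁, h₂]; ring⟩
  | monomial k r =>
    obtain ⟨⟨r₁, r₂, r₃, r₄⟩, rfl, -⟩ := existsUnique_elt r
    have hX : AdjoinRoot.mk (X ^ n - C α) X = mkF n α X := by rw [mkF_apply, map_X]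
    have hr : AdjoinRoot.mk (X ^ n - C α) (C (elt r₁ r₂ r₃ r₄)) = mkF n α (C r₁)
        + mkF n α (C r₂) * uBar n α + mkF n α (C r₃) * vBar n α
        + mkF n α (C r₄) * (uBar n α * vBar n α) := by
      simp only [← mk_C_algebraMap, uBar, vBar, elt, map_add, map_mul, AdjoinRoot.mk_C]
    have hv := yBar_pow_eq hw hα
    have hi := mkF_C_inv_mul (n := n) (α := α) hα₃
    refine ⟨(C r₁ + C r₃ * C α₃⁻¹ * (X ^ 2 - C a) ^ q) * X ^ k,
      (mkF n α (C r₂) + mkF n α (C r₄) * vBar n α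
        - mkF n α (C r₃) * mkF n α (C α₃⁻¹) * mkF n α (C α₄) * vBar n α) * mkF n α X ^ k, ?_⟩
    rw [← C_mul_X_pow_eq_monomial, map_mul, map_pow, hX, hr]
    simp only [map_mul, map_add, map_pow]
    rw [← yBar_eq, hv]
    linear_combination (-mkF n α (C r₃) * vBar n α * mkF n α X ^ k) * hi

theorem degree_map_lt {P : F[X]} (hP : P.degree < n) (r : RingUV F) :
    (C r * P.map (algebraMap F (RingUV F))).degree < n :=
  (by simpa [C_mul'] using degree_smul_le r _ : _ ≤ _).trans_lt (degree_map_le.trans_lt hP)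

/-- Expand Q = Q₀ + N Q₁ + N² Q₂ in base N = xⁿ - α₁, which maps to y^q. Then uQ = uQ₀ + α₃uv Q₁ has
a representative of degree below n, so Q₀ = Q₁ = 0. -/
theorem dvd_of_uBar_mul_mkF_eq_zero (hn : 0 < n) (hw : (X ^ 2 - C a : F[X]) ^ q = X ^ n - C α₁)
    (hα : α = elt α₁ 0 α₃ α₄) (hα₃ : α₃ ≠ 0) {Q : F[X]} (h : uBar n α * mkF n α Q = 0) :
    (X ^ 2 - C a) ^ (2 * q) ∣ Q := by
  have hN : (X ^ n - C α₁ : F[X]).Monic := monic_X_pow_sub_C α₁ hn.ne'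
  set N : F[X] := X ^ n - C α₁ with hNdef
  have hNdeg : N.degree = n := degree_X_pow_sub_C hn α₁
  have e1 : Q %ₘ N + N * (Q /ₘ N) = Q := modByMonic_add_div Q N
  have e2 : (Q /ₘ N) %ₘ N + N * (Q /ₘ N /ₘ N) = Q /ₘ N := modByMonic_add_div _ N
  have d0 : (Q %ₘ N).degree < n := hNdeg ▸ degree_modByMonic_lt Q hN
  have d1 : ((Q /ₘ N) %ₘ N).degree < n := hNdeg ▸ degree_modByMonic_lt _ hN
  set Q₀ := Q %ₘ N
  set Q₁ := (Q /ₘ N) %ₘ N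
  set Q₂ := Q /ₘ N /ₘ N
  have hQ : Q = Q₀ + N * Q₁ + N ^ 2 * Q₂ := by rw [← e1, ← e2]; ring
  have hyq : mkF n α N = yBar n α a ^ q := by rw [yBar_eq, ← map_pow, hw]
  have hy2 : yBar n α a ^ q * yBar n α a ^ q = 0 := by
    rw [← pow_add, ← two_mul, yBar_pow_two_mul_eq_zero hw hα]
  have hzero : AdjoinRoot.mk (R := RingUV F) (X ^ n - C α) (C (u F) * Q₀.map (algebraMap F (RingUV F))
      + C (algebraMap F _ α₃ * (u F * v F)) * Q₁.map (algebraMap F (RingUV F))) = 0 := by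
    have e : AdjoinRoot.mk (R := RingUV F) (X ^ n - C α) (C (u F) * Q₀.map (algebraMap F (RingUV F))
      + C (algebraMap F _ α₃ * (u F * v F)) * Q₁.map (algebraMap F (RingUV F)))
      = uBar n α * mkF n α Q₀ + mkF n α (C α₃) * (uBar n α * vBar n α) * mkF n α Q₁ := by
      simp only [uBar, vBar, map_add, map_mul, AdjoinRoot.mk_C, mkF_apply, map_C]
    rw [e, ← uBar_mul_yBar_pow hw hα, ← h, hQ]
    simp only [map_add, map_mul, map_pow, hyq]
    linear_combination (-uBar n α * mkF n α Q₂) * hy2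
  have hpoly := eq_zero_of_mk_eq_zero (R := RingUV F) hn
    ((degree_add_le _ _).trans_lt (max_lt (degree_map_lt d0 _) (degree_map_lt d1 _))) hzero
  have hcoeff : ∀ j, Q₀.coeff j = 0 ∧ α₃ * Q₁.coeff j = 0 := by
    intro j
    have := congrArg (coeff · j) hpoly
    simp only [coeff_add, coeff_C_mul, coeff_map, coeff_zero] at this
    refine eq_zero_of_elt_eq_zero ?_
    rw [← this, elt, map_zero, map_mul]
    ring
  have h0 : Q₀ = 0 := ext fun j => (hcoeff j).1
  have h1 : Q₁ = 0 := ext fun j => (mul_eq_zero.1 (hcoeff j).2).resolve_left hα₃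
  rw [hQ, h0, h1, mul_comm 2 q, pow_mul, hw]
  simp

theorem uIndex_le {g : ConstaRing (RingUV F) n α} {k : ℕ}
    (h : uBar n α * yBar n α a ^ k ∈ Ideal.span {g}) : uIndex a g ≤ k :=
  Nat.sInf_le h

/-- The codes `⟨yˡ + u yᵗ z, u y^μ⟩` and `⟨u y^μ⟩` have the same Hamming distance. -/
theorem idealHammingDist_span_pair (hn : 0 < n) (hw : (X ^ 2 - C a : F[X]) ^ q = X ^ n - C α₁)
    (hα : α = elt α₁ 0 α₃ α₄) (hα₃ : α₃ ≠ 0) {z : ConstaRing (RingUV F) n α}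
    (hz : z = 0 ∨ IsUnit z) {l t μ : ℕ} (hl : l ≤ 2 * q)
    (hμ : μ ≤ uIndex a (yBar n α a ^ l + uBar n α * yBar n α a ^ t * z)) :
    idealHammingDist (Ideal.span {yBar n α a ^ l + uBar n α * yBar n α a ^ t * z,
        uBar n α * yBar n α a ^ μ})
      = idealHammingDist (Ideal.span {uBar n α * yBar n α a ^ μ}) := by
  classical
  set y := yBar n α a with hy
  set u' := uBar n α with hu
  have huu : u' * u' = 0 := uBar_mul_uBar
  have hy0 : y ^ (2 * q) = 0 := yBar_pow_two_mul_eq_zero hw hα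
  have hmem : ∀ {k : ℕ} (b), μ ≤ k → u' * y ^ k * b ∈ Ideal.span {u' * y ^ μ} := by
    intro k b hk
    obtain ⟨j, rfl⟩ := Nat.exists_eq_add_of_le hk
    exact Ideal.mem_span_singleton.2 ⟨y ^ j * b, by rw [pow_add]; ring⟩
  -- Here u g = u y^l, as u² = 0.
  have hμl : μ ≤ l := hμ.trans (uIndex_le (Ideal.mem_span_singleton.2 ⟨u', by
    rw [← hy, ← hu]; linear_combination -(y ^ t * z) * huu⟩))
  refine idealHammingDist_eq_of_le (Ideal.span_mono (by simp)) fun c hc hc0 => ?_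
  by_cases h0 : (fun i => RingUV.u F * c i) = 0
  · refine ⟨c, ?_, hc0, le_rfl⟩
    rw [mem_code_iff] at hc ⊢
    have h1 := (smul_mem_code (α := α) (I := ⊥) (c := c) (RingUV.u F)).1 (by
      rw [h0]; exact zero_mem_code ⊥)
    rw [Ideal.mem_bot, ← uBar, ← hu] at h1
    generalize AdjoinRoot.mk (R := RingUV F) (X ^ n - C α) (∑ i : Fin n, C (c i) * X ^ (i : ℕ)) = e at hc h1 ⊢
    obtain ⟨b, d, rfl⟩ := Ideal.mem_span_pair.1 hc
    obtain ⟨P, b', rfl⟩ := exists_mkF_add_uBar_mul hw hα hα₃ b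
    -- From uc = 0 follows u y^l P = 0; hence P is a multiple of y^k with k = 2q - l.
    have h2 : uBar n α * mkF n α ((X ^ 2 - C a) ^ l * P) = 0 := by
      rw [map_mul, map_pow, ← yBar_eq, ← hy, ← hu]
      linear_combination h1 - (mkF n α P * y ^ t * z + b' * (y ^ l + u' * y ^ t * z) + d * y ^ μ) * huu
    have h3 := dvd_of_uBar_mul_mkF_eq_zero hn hw hα hα₃ h2
    obtain ⟨k, hk⟩ := Nat.exists_eq_add_of_le hl
    have hne : (X ^ 2 - C a : F[X]) ≠ 0 := X_pow_sub_C_ne_zero two_pos a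
    rw [hk, pow_add, mul_dvd_mul_iff_left (pow_ne_zero _ hne)] at h3
    obtain ⟨P', rfl⟩ := h3
    have hyk : y ^ l * y ^ k = 0 := by rw [← pow_add, ← hk, hy0]
    have hP : mkF n α ((X ^ 2 - C a) ^ k * P') = y ^ k * mkF n α P' := by
      rw [map_mul, map_pow, ← yBar_eq]
    have hsplit : (mkF n α ((X ^ 2 - C a) ^ k * P') + u' * b') * (y ^ l + u' * y ^ t * z)
        + d * (u' * y ^ μ) = u' * y ^ (k + t) * (z * mkF n α P') + u' * y ^ l * b'
        + u' * y ^ μ * d := by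
      rw [hP, pow_add]
      linear_combination mkF n α P' * hyk + (b' * y ^ t * z) * huu
    rw [hsplit]
    refine Ideal.add_mem _ (Ideal.add_mem _ ?_ (hmem _ hμl)) (hmem _ le_rfl)
    rcases hz with rfl | hz
    · simp
    -- Since y^(k+l) = 0, y^k g = u y^(k+t) z; inverting z puts u y^(k+t) in ⟨g⟩, so μ ≤ k + t.
    · refine hmem _ (hμ.trans (uIndex_le (Ideal.mem_span_singleton.2 ?_)))
      obtain ⟨z, rfl⟩ := hz
      refine ⟨y ^ k * ↑z⁻¹, ?_⟩
      rw [← hy, ← hu, pow_add]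
      linear_combination (-u' * y ^ k * y ^ t) * z.mul_inv - (↑z⁻¹ : ConstaRing _ n α) * hyk
  · refine ⟨_, ?_, h0, hammingNorm_comp_le_hammingNorm (fun _ => (RingUV.u F * ·)) (by simp)⟩
    rw [smul_mem_code]
    rw [mem_code_iff] at hc
    generalize AdjoinRoot.mk (R := RingUV F) (X ^ n - C α) (∑ i : Fin n, C (c i) * X ^ (i : ℕ)) = e at hc ⊢
    obtain ⟨b, d, rfl⟩ := Ideal.mem_span_pair.1 hc
    have := hmem b hμl
    rw [← uBar, ← hu]
    convert this using 1
    linear_combination (b * y ^ t * z + d * y ^ μ) * huu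

end

/-! ### Words and distance of ⟨u y^μ⟩ -/

section

open RingUV

variable {F : Type*} [Field F] {n : ℕ} {α : RingUV F} {a α₁ α₃ α₄ : F} {q : ℕ}

/-- The word of `uv f` for a polynomial `f` over the coefficient field. -/
def uvWord (n : ℕ) (f : F[X]) : Fin n → RingUV F :=
  fun i => u F * v F * algebraMap F (RingUV F) (f.coeff i)

theorem uvWord_eq (f : F[X]) : uvWord n f = fun i : Fin n =>
    (C (u F * v F) * f.map (algebraMap F (RingUV F))).coeff i := by
  funext i
  rw [coeff_C_mul, coeff_map, uvWord]

theorem uvWord_ne_zero {f : F[X]} (hf : f ≠ 0) (hdeg : f.natDegree < n) : uvWord n f ≠ 0 := by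
  intro h
  exact hf (leadingCoeff_eq_zero.1
    (uv_mul_algebraMap_eq_zero.1 (congrFun h (⟨f.natDegree, hdeg⟩ : Fin n))))

theorem uvWord_zero : uvWord n (0 : F[X]) = 0 := by
  funext i
  simp [uvWord]

open scoped Classical in
theorem hammingNorm_uvWord {f : F[X]} (hdeg : f.natDegree < n) :
    hammingNorm (uvWord n f) = f.support.card := by
  refine Finset.card_bij (fun i _ => (i : ℕ)) ?_ (fun _ _ _ _ h => Fin.ext h) ?_
  · intro i hi
    exact mem_support_iff.2 fun h =>
      (Finset.mem_filter.1 hi).2 (uv_mul_algebraMap_eq_zero.2 h)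
  · intro j hj
    refine ⟨⟨j, (le_natDegree_of_mem_supp j hj).trans_lt hdeg⟩, ?_, rfl⟩
    exact Finset.mem_filter.2 ⟨Finset.mem_univ _, fun h =>
      mem_support_iff.1 hj (uv_mul_algebraMap_eq_zero.1 h)⟩

theorem mk_C_uv_mul (f : F[X]) :
    AdjoinRoot.mk (R := RingUV F) (X ^ n - C α) (C (u F * v F) * f.map (algebraMap F (RingUV F)))
      = uBar n α * vBar n α * mkF n α f := by
  simp only [uBar, vBar, map_mul, AdjoinRoot.mk_C, mkF_apply]

theorem uvWord_mem_code_iff {I : Ideal (ConstaRing (RingUV F) n α)} {f : F[X]}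
    (hdeg : f.degree < n) : uvWord n f ∈ code I ↔ uBar n α * vBar n α * mkF n α f ∈ I := by
  rw [uvWord_eq, ← mk_C_uv_mul]
  exact coeff_mem_code_iff (degree_map_lt hdeg _)

theorem uvWord_mem_code (hw : (X ^ 2 - C a : F[X]) ^ q = X ^ n - C α₁)
    (hα : α = elt α₁ 0 α₃ α₄) (hα₃ : α₃ ≠ 0) {i : ℕ} {f : F[X]} (hdeg : f.degree < n)
    (hdvd : (X ^ 2 - C a) ^ i ∣ f) :
    uvWord n f ∈ code (Ideal.span {uBar n α * yBar n α a ^ (q + i)}) := by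
  rw [uvWord_mem_code_iff hdeg, Ideal.mem_span_singleton]
  obtain ⟨g, rfl⟩ := hdvd
  refine ⟨mkF n α (C α₃⁻¹) * mkF n α g, ?_⟩
  rw [pow_add, ← mul_assoc (uBar n α), uBar_mul_yBar_pow hw hα, map_mul, map_pow, ← yBar_eq]
  linear_combination (-(uBar n α * vBar n α) * yBar n α a ^ i * mkF n α g) *
    mkF_C_inv_mul (n := n) (α := α) hα₃

theorem uBar_mul_vBar_mul_mkF_eq_zero (hw : (X ^ 2 - C a : F[X]) ^ q = X ^ n - C α₁)
    (hα : α = elt α₁ 0 α₃ α₄) : uBar n α * vBar n α * mkF n α (X ^ n - C α₁) = 0 := by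
  rw [← hw, map_pow, ← yBar_eq, yBar_pow_eq hw hα]
  linear_combination (uBar n α * mkF n α (C α₃) + uBar n α * uBar n α * mkF n α (C α₄)) *
    vBar_mul_vBar (α := α)

theorem exists_eq_uvWord (hn : 0 < n) (hw : (X ^ 2 - C a : F[X]) ^ q = X ^ n - C α₁)
    (hα : α = elt α₁ 0 α₃ α₄) {i : ℕ} (hi : i ≤ q) {c : Fin n → RingUV F}
    (hc : c ∈ code (Ideal.span {uBar n α * yBar n α a ^ (q + i)})) :
    ∃ f : F[X], f.degree < n ∧ (X ^ 2 - C a) ^ i ∣ f ∧ c = uvWord n f := by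
  rw [mem_code_iff, Ideal.mem_span_singleton] at hc
  obtain ⟨b, hb⟩ := hc
  obtain ⟨B, rfl⟩ := AdjoinRoot.mk_surjective b
  obtain ⟨Q, hQ⟩ := C_uv_mul B
  have hN : (X ^ n - C α₁ : F[X]).Monic := monic_X_pow_sub_C α₁ hn.ne'
  set P : F[X] := C α₃ * (X ^ 2 - C a) ^ i * Q with hP
  have hdeg : (P %ₘ (X ^ n - C α₁)).degree < n :=
    degree_X_pow_sub_C (R := F) hn α₁ ▸ degree_modByMonic_lt P hN
  have hdiv := modByMonic_add_div P (X ^ n - C α₁)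
  -- The modulus is (x² - a)^q and i ≤ q, so reduction preserves divisibility.
  have hdvd : (X ^ 2 - C a) ^ i ∣ P %ₘ (X ^ n - C α₁) := by
    rw [modByMonic_eq_sub_mul_div]
    refine dvd_sub ((Dvd.intro_left _ rfl).mul_right _) (Dvd.dvd.mul_right ?_ _)
    rw [← hw]
    exact pow_dvd_pow _ hi
  refine ⟨_, hdeg, hdvd, ?_⟩
  have hQ' := congrArg (AdjoinRoot.mk (R := RingUV F) (X ^ n - C α)) hQ
  rw [mk_C_uv_mul, map_mul, AdjoinRoot.mk_C, map_mul, ← uBar, ← vBar] at hQ'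
  have hmk : AdjoinRoot.mk (R := RingUV F) (X ^ n - C α)
      (∑ i : Fin n, C (c i) * X ^ (i : ℕ) - C (u F * v F) *
        (P %ₘ (X ^ n - C α₁)).map (algebraMap F (RingUV F))) = 0 := by
    rw [map_sub, hb, mk_C_uv_mul, sub_eq_zero, pow_add, ← mul_assoc, uBar_mul_yBar_pow hw hα]
    have h1 := congrArg (mkF n α) hdiv
    rw [hP, map_add, map_mul, map_mul, map_mul, map_pow, ← yBar_eq, ← hP] at h1
    linear_combination (mkF n α (C α₃) * yBar n α a ^ i) * hQ' - (uBar n α * vBar n α) * h1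
      + mkF n α (P /ₘ (X ^ n - C α₁)) * uBar_mul_vBar_mul_mkF_eq_zero hw hα
  have h0 := eq_zero_of_mk_eq_zero (R := RingUV F) hn
    ((degree_sub_le _ _).trans_lt (max_lt (degree_sum_lt c) (degree_map_lt hdeg _))) hmk
  funext j
  rw [uvWord_eq, ← sub_eq_zero.1 h0]
  exact (ConstaRing.coeff_sum c j).symm

theorem idealHammingDist_span_uBar_mul_yBar_pow_eq_one (hn : 0 < n)
    (hw : (X ^ 2 - C a : F[X]) ^ q = X ^ n - C α₁)
    (hα : α = elt α₁ 0 α₃ α₄) (hα₃ : α₃ ≠ 0) {μ : ℕ} (hμ : μ ≤ q) :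
    idealHammingDist (Ideal.span {uBar n α * yBar n α a ^ μ}) = 1 := by
  classical
  refine idealHammingDist_eq ⟨uvWord n 1, ?_, uvWord_ne_zero one_ne_zero (by simpa using hn), ?_⟩
    fun c _ hc => Nat.one_le_iff_ne_zero.2 (hammingNorm_ne_zero_iff.2 hc)
  · have h1 := uvWord_mem_code hw hα hα₃ (i := 0) (f := 1)
      (by rw [degree_one]; exact_mod_cast hn) (by simp)
    rw [mem_code_iff] at h1 ⊢
    refine (Ideal.span_singleton_le_span_singleton.2 ?_) h1
    exact mul_dvd_mul_left _ (pow_dvd_pow _ hμ)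
  · rw [hammingNorm_uvWord (by simpa using hn), ← C_1]
    exact (Finset.card_le_card (support_C_subset 1)).trans (by simp)

/-- The Hamming distance of `⟨u (x² - a) ^ (pˢ + i)⟩`, where `s = e + γ + 1`. -/
theorem idealHammingDist_span_uBar_mul_yBar_pow (p : ℕ) [hp : Fact p.Prime] [CharP F p]
    {e k γ i : ℕ} (hq : q = p ^ (e + γ + 1)) (hn : n = 2 * q) (ha : a ≠ 0)
    (hw : (X ^ 2 - C a : F[X]) ^ q = X ^ n - C α₁)
    (hα : α = elt α₁ 0 α₃ α₄) (hα₃ : α₃ ≠ 0) (hk : k + 2 ≤ p)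
    (hi : q + k * p ^ e + 1 ≤ p ^ (e + 1) + i) (hi' : i + p ^ (e + 1) ≤ q + (k + 1) * p ^ e) :
    idealHammingDist (Ideal.span {uBar n α * yBar n α a ^ (q + i)}) = (k + 2) * p ^ γ := by
  classical
  have hpe : 0 < p ^ e := pow_pos hp.out.pos e
  have hle : p ^ (e + 1) ≤ q := hq ▸ Nat.pow_le_pow_right hp.out.pos (by omega)
  have hpk : (k + 1) * p ^ e + p ^ e ≤ p ^ (e + 1) := by
    rw [pow_succ']
    calc _ = (k + 2) * p ^ e := by ring
      _ ≤ _ := Nat.mul_le_mul_right _ hk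
  have hn0 : 0 < n := by omega
  -- The largest exponent allowed for i: its power of X² - a is the sparse word attaining the bound.
  obtain ⟨j, hj⟩ : ∃ j, j + p ^ (e + 1) = q + (k + 1) * p ^ e :=
    ⟨q + (k + 1) * p ^ e - p ^ (e + 1), by omega⟩
  have hdeg : ((X ^ 2 - C a : F[X]) ^ j).natDegree < n := by
    rw [natDegree_pow, natDegree_X_pow_sub_C]
    omega
  have hne : (X ^ 2 - C a : F[X]) ^ j ≠ 0 := pow_ne_zero _ (X_pow_sub_C_ne_zero two_pos a)
  refine idealHammingDist_eq ⟨uvWord n ((X ^ 2 - C a) ^ j), ?_, ?_, ?_⟩ fun c hc hc0 => ?_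
  · exact uvWord_mem_code hw hα hα₃ ((natDegree_lt_iff_degree_lt hne).1 hdeg)
      (pow_dvd_pow _ (by omega))
  · exact uvWord_ne_zero hne hdeg
  · rw [hammingNorm_uvWord hdeg]
    have hexp : expand F 2 ((X - C a) ^ j) = (X ^ 2 - C a) ^ j := by simp
    rw [← hexp]
    exact (card_support_expand two_pos _).trans
      (card_support_X_sub_C_pow_le p a e (k + 1) γ j (hq ▸ hj))
  · obtain ⟨f, hf, hdvd, rfl⟩ := exists_eq_uvWord hn0 hw hα (by omega) hc
    have hf0 : f ≠ 0 := fun h => hc0 (h ▸ uvWord_zero)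
    have hf' := (natDegree_lt_iff_degree_lt hf0).2 hf
    rw [hammingNorm_uvWord hf']
    obtain ⟨g, hg0, hg, hgdvd, hgle⟩ :=
      exists_X_sub_C_pow_dvd_of_X_sq_sub_C_pow_dvd (N := q) ha hf0 (hn ▸ hf') hdvd
    exact (mul_pow_le_card_support p ha e k γ i hg0 (hq ▸ hg) (hq ▸ hi) hgdvd).trans hgle

/-- The total exponent of p is a multiple of m, so this is an iterate of the identity b ↦ b^(p^m).
-/
theorem alphaZero_pow [Fintype F] (p m s : ℕ) (hm : 0 < m) (hF : Fintype.card F = p ^ m)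
    (b : F) : alphaZero p m s b ^ p ^ s = b := by
  have hlt := Nat.mod_lt s hm
  rw [alphaZero, ← pow_mul, ← pow_add,
    show m - s % m + s = m * (s / m + 1) by have := Nat.div_add_mod s m; rw [mul_add]; omega,
    pow_mul, ← hF, FiniteField.pow_card_pow]

end

end

/-! ### The distance formula -/

theorem theorem10 {F : Type*} [Field F] [Fintype F] (p m s : ℕ)
    (hp : p.Prime) (hp_odd : Odd p) (hm : 0 < m) (hs : 0 < s)
    (hF : Fintype.card F = p ^ m)
    (α₁ α₃ α₄ : F) (hα₁ : α₁ ≠ 0) (hα₃ : α₃ ≠ 0)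
    (α : RingUV F) (hα : α = RingUV.elt α₁ 0 α₃ α₄) (hα_sq : ¬ IsSquare α)
    (u y z : ConstaRing (RingUV F) (2 * p ^ s) α)
    (hu : u = uBar (2 * p ^ s) α)
    (hy : y = yBar (2 * p ^ s) α (alphaZero p m s α₁))
    (hz : z = 0 ∨ IsUnit z)
    (l t μ : ℕ) (hl : l ≤ 2 * p ^ s - 1) (ht : t < l)
    (hμ : μ ≤ uIndex (alphaZero p m s α₁) (y ^ l + u * y ^ t * z)) :
    (μ ≤ p ^ s →
      idealHammingDist (Ideal.span {y ^ l + u * y ^ t * z, u * y ^ μ}) = 1) ∧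
    (∀ Γ γ : ℕ, 1 ≤ Γ → Γ ≤ p - 1 → γ ≤ s - 1 →
      2 * p ^ s - p ^ (s - γ) + (Γ - 1) * p ^ (s - γ - 1) + 1 ≤ μ →
      μ ≤ 2 * p ^ s - p ^ (s - γ) + Γ * p ^ (s - γ - 1) →
      idealHammingDist (Ideal.span {y ^ l + u * y ^ t * z, u * y ^ μ}) = (Γ + 1) * p ^ γ) ∧
    idealHammingDist (Ideal.span {y ^ l + u * y ^ t * z, u * y ^ μ})
      = idealHammingDist (Ideal.span {u * y ^ μ}) := by
  subst hu hy
  have := Fact.mk hp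
  have : CharP F p := charP_of_card_eq_prime_pow hF
  have ha := alphaZero_pow p m s hm hF α₁
  set a := alphaZero p m s α₁
  have hq : 0 < p ^ s := pow_pos hp.pos s
  have ha0 : a ≠ 0 := by
    intro h
    rw [h, zero_pow hq.ne'] at ha
    exact hα₁ ha.symm
  have hw : (X ^ 2 - C a : F[X]) ^ p ^ s = X ^ (2 * p ^ s) - C α₁ := by
    rw [sub_pow_char_pow, ← pow_mul, ← C_pow, ha]
  have hpair := idealHammingDist_span_pair (by omega) hw hα hα₃ hz (by omega) hμ
  refine ⟨fun hμs => ?_, fun Γ γ hΓ hΓp hγ h₁ h₂ => ?_, hpair⟩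
  · rw [hpair]
    exact idealHammingDist_span_uBar_mul_yBar_pow_eq_one (by omega) hw hα hα₃ hμs
  -- Setting s = e + γ + 1, Γ = k + 1 and μ = p^s + i removes the truncated subtractions.
  · obtain ⟨e, rfl⟩ : ∃ e, s = e + γ + 1 := ⟨s - γ - 1, by omega⟩
    obtain ⟨k, rfl⟩ : ∃ k, Γ = k + 1 := ⟨Γ - 1, by omega⟩
    rw [show e + γ + 1 - γ = e + 1 by omega, Nat.add_sub_cancel] at h₁ h₂
    rw [Nat.add_sub_cancel] at h₁
    have hle : p ^ (e + 1) ≤ p ^ (e + γ + 1) := Nat.pow_le_pow_right hp.pos (by omega)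
    obtain ⟨i, rfl⟩ : ∃ i, μ = p ^ (e + γ + 1) + i := Nat.exists_eq_add_of_le (by omega)
    rw [hpair]
    exact idealHammingDist_span_uBar_mul_yBar_pow p rfl rfl ha0 hw hα hα₃ (by omega) (by omega)
      (by omega)
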